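/- Let $n\ge 3$, let $\mathcal X$ be a finite set with $|\mathcal X|=n$, let $\hat{\mathcal X}$ be an arbitrary (measurable) reconstruction alphabet and let $\ell:\mathcal X\times\hat{\mathcal X}\to[-\infty,\infty]$ be a loss function, measurable in its second argument. For random variables $X\in\mathcal X$ and $Y$ put $$C(\ell,P_{XY})=\inf_{\hat x\in\hat{\mathcal X}}\mathbb E[\ell(X,\hat x)]-\inf_{\hat X(Y)}\mathbb E[\ell(X,\hat X(Y))],$$ where the second infimum is over all measurable functions $\hat X(Y)\in\hat{\mathcal X}$ of $Y$. Assume that, for all $P_{XY}$ with $Y$ finitely valued, no indeterminate form $\infty-\infty$ occurs in this difference, and that $\ell$ satisfies the Data Processing Axiom: for all finitely valued $Y$, $$C(\ell,P_{TY})\le C(\ell,P_{XY})$$ whenever $T\in\mathcal X$ is a statistically sufficient transformation of $X$ for $Y$, that is, whenever both $T-X-Y$ and $X-T-Y$ are Markov chains ($T$ may be a randomized function of $X$). Then there is a constant $c\ge 0$, depending only on $\ell$, such that for all jointly distributed random variables $X\in\mathcal X$, $Y$, $W$, where $Y$ and $W$ take values in arbitrary measurable spaces, $$\inf_{\hat X_1(W)}\mathbb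 E[\ell(X,\hat X_1(W))]-\inf_{\hat X_2(Y,W)}\mathbb E[\ell(X,\hat X_2(Y,W))]=c\,I(X;Y|W),$$ where the infima are over measurable estimators, both are finite, and $I(X;Y|W)=H(X|W)-H(X|Y,W)$ is the conditional mutual information. -/

import Mathlib

open MeasureTheory
open scoped ENNReal

noncomputable section

namespace SideInfo

/-- Expectation of an extended-real random variable, `E[f⁺] - E[f⁻]`. -/
def expect {Ω : Type*} [MeasurableSpace Ω] (μ : Measure Ω) (f : Ω → EReal) : EReal :=
  ((∫⁻ ω, (f ω).toENNReal ∂μ : ℝ≥0∞) : EReal) - ((∫⁻ ω, (-f ω).toENNReal ∂μ : ℝ≥0∞) : EReal)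

/-- Optimal risk without side information: the infimum of `E[ℓ(X, a)]` over deterministic `a`. -/
def risk {n : ℕ} {A Ω : Type*} [MeasurableSpace Ω] (ℓ : Fin n → A → EReal) (μ : Measure Ω)
    (X : Ω → Fin n) : EReal :=
  ⨅ a : A, expect μ (fun ω => ℓ (X ω) a)

/-- Optimal risk with side information `S`: the infimum of `E[ℓ(X, g(S))]` over measurable
estimators `g`. -/
def riskGiven {n : ℕ} {A Ω 𝒮 : Type*} [MeasurableSpace A] [MeasurableSpace Ω] [MeasurableSpace 𝒮]
    (ℓ : Fin n → A → EReal) (μ : Measure Ω) (X : Ω → Fin n) (S : Ω → 𝒮) : EReal :=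
  ⨅ g : {g : 𝒮 → A // Measurable g}, expect μ (fun ω => ℓ (X ω) (g.1 (S ω)))

/-- The benefit `C(ℓ, P_{XY})` of the side information `Y` for inference on `X`. -/
def benefit {n : ℕ} {A Ω 𝒴 : Type*} [MeasurableSpace A] [MeasurableSpace Ω] [MeasurableSpace 𝒴]
    (ℓ : Fin n → A → EReal) (μ : Measure Ω) (X : Ω → Fin n) (Y : Ω → 𝒴) : EReal :=
  risk ℓ μ X - riskGiven ℓ μ X Y

/-- The benefit of additional side information `Y` for inference on `X`, with common side
information `W`. -/
def benefitGiven {n : ℕ} {A Ω 𝒴 𝒲 : Type*} [MeasurableSpace A] [MeasurableSpace Ω]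
    [MeasurableSpace 𝒴] [MeasurableSpace 𝒲] (ℓ : Fin n → A → EReal) (μ : Measure Ω)
    (X : Ω → Fin n) (Y : Ω → 𝒴) (W : Ω → 𝒲) : EReal :=
  riskGiven ℓ μ X W - riskGiven ℓ μ X (fun ω => (Y ω, W ω))

/-- No indeterminate form `∞ - ∞` appears in `C(ℓ, P_{XY})`, for any `X` and any finitely
valued `Y`. -/
def WellDefined {n : ℕ} {A : Type*} [MeasurableSpace A] (ℓ : Fin n → A → EReal) : Prop :=
  ∀ (Ω : Type) [MeasurableSpace Ω] (μ : Measure Ω) [IsProbabilityMeasure μ]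
    (m : ℕ) (X : Ω → Fin n) (Y : Ω → Fin m), Measurable X → Measurable Y →
    ¬ (risk ℓ μ X = ⊤ ∧ riskGiven ℓ μ X Y = ⊤) ∧ ¬ (risk ℓ μ X = ⊥ ∧ riskGiven ℓ μ X Y = ⊥)

/-- `U - V - Z` is a Markov chain (finite alphabets): `P(u,v,z) P(v) = P(u,v) P(v,z)`. -/
def MarkovChain {Ω 𝒰 𝒱 𝒵 : Type*} [MeasurableSpace Ω] (μ : Measure Ω)
    (U : Ω → 𝒰) (V : Ω → 𝒱) (Z : Ω → 𝒵) : Prop :=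
  ∀ u v z, μ {ω | U ω = u ∧ V ω = v ∧ Z ω = z} * μ {ω | V ω = v} =
    μ {ω | U ω = u ∧ V ω = v} * μ {ω | V ω = v ∧ Z ω = z}

/-- `T` is a statistically sufficient transformation of `X` for `Y`: `T - X - Y` and
`X - T - Y` are Markov chains. The first chain says that `T` is obtained from `X`, possibly
with independent randomization. -/
def Sufficient {Ω 𝒯 𝒳 𝒴 : Type*} [MeasurableSpace Ω] (μ : Measure Ω)
    (T : Ω → 𝒯) (X : Ω → 𝒳) (Y : Ω → 𝒴) : Prop :=
  MarkovChain μ T X Y ∧ MarkovChain μ X T Y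

/-- The Data Processing Axiom: `C(ℓ, P_{TY}) ≤ C(ℓ, P_{XY})` whenever `T`, with values in the
alphabet of `X`, is a statistically sufficient transformation of `X` for `Y`. It is demanded only
for finitely valued `Y`, which is less than demanding it for all `Y`. -/
def DataProcessingAxiom {n : ℕ} {A : Type*} [MeasurableSpace A] (ℓ : Fin n → A → EReal) : Prop :=
  ∀ (Ω : Type) [MeasurableSpace Ω] (μ : Measure Ω) [IsProbabilityMeasure μ]
    (m : ℕ) (X T : Ω → Fin n) (Y : Ω → Fin m), Measurable X → Measurable T → Measurable Y →
    Sufficient μ T X Y → benefit ℓ μ T Y ≤ benefit ℓ μ X Y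

/-- The conditional entropy `H(X | S) = E[-∑ₓ P(X = x | S) log P(X = x | S)]`, in nats. -/
def condEntropy {n : ℕ} {Ω 𝒮 : Type*} [MeasurableSpace Ω] [mS : MeasurableSpace 𝒮]
    (μ : Measure Ω) (X : Ω → Fin n) (S : Ω → 𝒮) : ℝ :=
  ∫ ω, ∑ x : Fin n,
    Real.negMulLog ((μ[(X ⁻¹' {x}).indicator (fun _ => (1 : ℝ)) | mS.comap S]) ω) ∂μ

/-- The conditional mutual information `I(X; Y | W) = H(X | W) - H(X | Y, W)`. -/
def condMutualInfo {n : ℕ} {Ω 𝒴 𝒲 : Type*} [MeasurableSpace Ω] [MeasurableSpace 𝒴]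
    [MeasurableSpace 𝒲] (μ : Measure Ω) (X : Ω → Fin n) (Y : Ω → 𝒴) (W : Ω → 𝒲) : ℝ :=
  condEntropy μ X W - condEntropy μ X (fun ω => (Y ω, W ω))

end SideInfo

end

namespace SideInfo

/-! Subtracting from `ℓ x` its infimum `m x`, which is finite, leaves an excess `e ≥ 0`, and the
term E m(X) cancels from every benefit. What remains is governed by V(p) = inf_a ∑ p(x) e(x,a) on
the cone of unnormalised laws, which is homogeneous, superadditive and zero at the vertices. For
two-valued Y the benefit is the defect V(p+q) − V(p) − V(q), where p and q are the masses of X on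
the two values of Y. A sufficient transformation can be reversed, so the axiom, used in both
directions, makes the defect invariant (`IsNormalized.isSufficiencyInvariant`).

Invariance says that V(p') − V(p) is additive in p when p' depends additively on p through fixed
channels, so its values at the vertices determine it (`eq_sum_of_additive`). For permutations it
vanishes, and V is symmetric. For the random splitting of a letter it gives the chain rule
`eq_merge_add`. Merging three letters in two orders, possible because n ≥ 3, gives a cocycle
equation for V on two-letter vectors. Differentiating it, which concavity permits, leaves a monotone
solution of the logarithm equation (`cocycle_eq_entropy`). The chain rule then yields c times
entropy on the whole cone (`eq_entropy`).

For arbitrary side information S, near-optimal actions can be selected measurably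
(`iInf_lintegral_eq_lintegral_bayes`). The optimal risk is therefore E m(X) + E V(P(X|S)) = E m(X) +
c H(X|S), and two such risks are subtracted. -/

/-! ### Functional equations for the logarithm and the entropy cocycle -/

/-- A monotone additive function on the positive reals is linear. -/
lemma eq_mul_of_additive_of_monotone {f : ℝ → ℝ}
    (hadd : ∀ s t, 0 < s → 0 < t → f (s + t) = f s + f t)
    (hmono : ∀ s t, 0 < s → s < t → f s ≤ f t) {t : ℝ} (ht : 0 < t) : f t = t * f 1 := by
  have hnonneg : ∀ s, 0 < s → 0 ≤ f s := by
    intro s hs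
    have h1 := hadd s s hs hs
    have h2 := hmono s (s + s) hs (by linarith)
    linarith
  have hnat : ∀ (k : ℕ) (s : ℝ), 0 < s → f (((k : ℝ) + 1) * s) = ((k : ℝ) + 1) * f s := by
    intro k s hs
    induction k with
    | zero => simp
    | succ k ih =>
      have : (((k + 1 : ℕ) : ℝ) + 1) * s = ((k : ℝ) + 1) * s + s := by push_cast; ring
      rw [this, hadd _ _ (by positivity) hs, ih]
      push_cast; ring
  -- With j ≤ Nt < j + 1, both N f(t) and N t f(1) lie between j f(1) and (j + 1) f(1), so the error
  -- is at most f(1)/N for every N.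
  have hbound : ∀ k : ℕ, |f t - t * f 1| * ((k : ℝ) + 1) ≤ f 1 := by
    intro k
    set N : ℝ := (k : ℝ) + 1 with hN
    have hNpos : 0 < N := by positivity
    have hNt : 0 < N * t := by positivity
    obtain ⟨j, hj1, hj2⟩ : ∃ j : ℕ, (j : ℝ) ≤ N * t ∧ N * t < j + 1 :=
      ⟨⌊N * t⌋₊, Nat.floor_le hNt.le, Nat.lt_floor_add_one _⟩
    have hup : f (N * t) ≤ ((j : ℝ) + 1) * f 1 := by
      rw [← hnat j 1 one_pos, mul_one]
      exact hmono _ _ hNt hj2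
    have hlow : (j : ℝ) * f 1 ≤ f (N * t) := by
      rcases Nat.eq_zero_or_pos j with rfl | hjpos
      · simpa using hnonneg _ hNt
      · obtain ⟨i, rfl⟩ : ∃ i, j = i + 1 := ⟨j - 1, by omega⟩
        push_cast at hj1 ⊢
        rw [← hnat i 1 one_pos, mul_one]
        rcases hj1.lt_or_eq with h | h
        · exact hmono _ _ (by positivity) h
        · rw [h]
    rw [hnat k t ht] at hup hlow
    have h1 := hnonneg 1 one_pos
    rw [← abs_of_pos hNpos, ← abs_mul, abs_le]
    constructor <;> nlinarith
  by_contra hne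
  have hpos : 0 < |f t - t * f 1| := abs_pos.2 (sub_ne_zero.2 hne)
  obtain ⟨k, hk⟩ := exists_nat_gt (f 1 / |f t - t * f 1|)
  rw [div_lt_iff₀ hpos] at hk
  have := hbound k
  nlinarith

/-- A monotone function turning products of numbers above `1` into sums is a multiple of `log`. -/
lemma eq_mul_log_of_monotone {m : ℝ → ℝ} (hmul : ∀ u v, 1 < u → 1 < v → m (u * v) = m u + m v)
    (hmono : ∀ u v, 1 < u → u < v → m u ≤ m v) :
    ∃ c : ℝ, ∀ u, 1 < u → m u = c * Real.log u := by
  refine ⟨m (Real.exp 1), fun u hu => ?_⟩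
  have h := eq_mul_of_additive_of_monotone (f := fun t => m (Real.exp t))
    (fun s t hs ht => by
      rw [Real.exp_add]; exact hmul _ _ (Real.one_lt_exp_iff.2 hs) (Real.one_lt_exp_iff.2 ht))
    (fun s t hs hst => hmono _ _ (Real.one_lt_exp_iff.2 hs) (Real.exp_lt_exp.2 hst))
    (Real.log_pos hu)
  simp only [Real.exp_log (zero_lt_one.trans hu)] at h
  rw [h, mul_comm]

/-- A concave homogeneous symmetric cocycle is a multiple of the entropy cocycle. -/
theorem cocycle_eq_entropy {F : ℝ → ℝ → ℝ}
    (hsymm : ∀ x y, 0 < x → 0 < y → F x y = F y x)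
    (hhom : ∀ c x y, 0 < c → 0 < x → 0 < y → F (c * x) (c * y) = c * F x y)
    (hconc : ∀ y, 0 < y → ConcaveOn ℝ (Set.Ioi 0) (fun x => F x y))
    (hcoc : ∀ x y z, 0 < x → 0 < y → 0 < z → F (x + y) z + F x y = F x (y + z) + F y z)
    (hnonneg : ∀ x y, 0 < x → 0 < y → 0 ≤ F x y) :
    ∃ c : ℝ, 0 ≤ c ∧ ∀ x y, 0 < x → 0 < y →
      F x y = c * ((x + y) * Real.log (x + y) - x * Real.log x - y * Real.log y) := by
  -- D is the right derivative of F in its first variable; concavity makes it exist and decrease.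
  obtain ⟨D, hD, hDmono⟩ : ∃ D : ℝ → ℝ → ℝ,
      (∀ x y, 0 < x → 0 < y → HasDerivWithinAt (fun t => F t y) (D x y) (Set.Ioi x) x) ∧
      (∀ x x' y, 0 < x → x < x' → 0 < y → D x' y ≤ D x y) := by
    refine ⟨fun x y => - derivWithin (-fun t => F t y) (Set.Ioi x) x, ?_, ?_⟩
    · intro x y hx hy
      have h := (hconc y hy).neg.hasDerivWithinAt_rightDeriv_of_mem_interior
        (x := x) (by simpa using hx)
      simpa using h.neg
    · intro x x' y hx hxx hy
      have h := (hconc y hy).neg.monotoneOn_rightDeriv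
      have := h (a := x) (b := x') (by simpa using hx) (by simpa using hx.trans hxx) hxx.le
      simpa using this
  have huniq : ∀ x : ℝ, UniqueDiffWithinAt ℝ (Set.Ioi x) x := fun x => uniqueDiffWithinAt_Ioi x
  -- Differentiating the cocycle equation in x removes the term F y z.
  have hDcoc : ∀ x y z, 0 < x → 0 < y → 0 < z → D (x + y) z + D x y = D x (y + z) := by
    intro x y z hx hy hz
    have h1 : HasDerivWithinAt (fun t => F (t + y) z) (D (x + y) z) (Set.Ioi x) x := by
      have := (hD (x + y) z (by positivity) hz).scomp x
        (((hasDerivAt_id x).add_const y).hasDerivWithinAt (s := Set.Ioi x))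
        (fun t ht => by simpa using ht)
      simpa [Function.comp_def] using this
    have h2 : HasDerivWithinAt (fun t => F t (y + z) + F y z) (D x (y + z)) (Set.Ioi x) x :=
      (hD x (y + z) hx (by positivity)).add_const _
    have h3 : HasDerivWithinAt (fun t => F (t + y) z + F t y) (D x (y + z)) (Set.Ioi x) x :=
      h2.congr (fun t ht => hcoc t y z (hx.trans ht) hy hz) (hcoc x y z hx hy hz)
    exact (huniq x).eq_deriv _ (h1.add (hD x y hx hy)) h3
  have hDhom : ∀ c x y, 0 < c → 0 < x → 0 < y → D (c * x) (c * y) = D x y := by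
    intro c x y hc hx hy
    have h1 : HasDerivWithinAt (fun t => F (c * t) (c * y)) (c * D (c * x) (c * y))
        (Set.Ioi x) x := by
      have := (hD (c * x) (c * y) (by positivity) (by positivity)).scomp x
        (((hasDerivAt_id x).const_mul c).hasDerivWithinAt (s := Set.Ioi x))
        (fun t ht => by simpa using mul_lt_mul_of_pos_left ht hc)
      simpa [Function.comp_def] using this
    have h2 : HasDerivWithinAt (fun t => F (c * t) (c * y)) (c * D x y) (Set.Ioi x) x :=
      ((hD x y hx hy).const_mul c).congr (fun t ht => hhom c t y hc (hx.trans ht) hy)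
        (hhom c x y hc hx hy)
    exact mul_left_cancel₀ hc.ne' ((huniq x).eq_deriv _ h1 h2)
  -- D is homogeneous of degree 0, so D u (u(v − 1)) = D 1 (v − 1), and the cocycle at (1, u − 1,
  -- u(v − 1)) becomes multiplicativity. Monotonicity comes from rescaling D 1 (u − 1) to D λ (v −
  -- 1) with λ = (v − 1)/(u − 1) > 1.
  obtain ⟨c, hc⟩ := eq_mul_log_of_monotone (m := fun u => D 1 (u - 1))
    (fun u v hu hv => by
      have h1 := hDcoc 1 (u - 1) (u * (v - 1)) one_pos (by linarith)
        (mul_pos (by linarith) (by linarith))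
      have h2 := hDhom u 1 (v - 1) (by linarith) one_pos (by linarith)
      rw [mul_one] at h2
      rw [add_sub_cancel, h2] at h1
      rw [show u * v - 1 = u - 1 + u * (v - 1) by ring, ← h1, add_comm])
    (fun u v hu huv => by
      have hu' : 0 < u - 1 := by linarith
      have h := hDhom ((v - 1) / (u - 1)) 1 (u - 1) (div_pos (by linarith) hu') one_pos hu'
      rw [mul_one, div_mul_cancel₀ _ hu'.ne'] at h
      rw [← h]
      exact hDmono _ _ _ one_pos ((one_lt_div hu').2 (by linarith)) (by linarith))
  have hDlog : ∀ x y, 0 < x → 0 < y → D x y = c * (Real.log (x + y) - Real.log x) := by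
    intro x y hx hy
    have h := hDhom x 1 (y / x) hx one_pos (by positivity)
    rw [mul_one, mul_div_cancel₀ _ hx.ne'] at h
    have h2 := hc (1 + y / x) (by simpa using div_pos hy hx)
    rw [add_sub_cancel_left] at h2
    rw [h, h2, ← Real.log_div (by positivity) hx.ne']
    congr 2; field_simp
  set G : ℝ → ℝ → ℝ := fun x y =>
    F x y - c * ((x + y) * Real.log (x + y) - x * Real.log x - y * Real.log y) with hG
  have hGderiv : ∀ x y, 0 < x → 0 < y → HasDerivWithinAt (fun t => G t y) 0 (Set.Ici x) x := by
    intro x y hx hy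
    have h1 : HasDerivAt (fun t => (t + y) * Real.log (t + y)) (Real.log (x + y) + 1) x := by
      have := (Real.hasDerivAt_mul_log (x := x + y) (by positivity)).comp x
        ((hasDerivAt_id x).add_const y)
      simpa [Function.comp_def] using this
    have h2 := ((h1.sub (Real.hasDerivAt_mul_log hx.ne')).sub_const (y * Real.log y)).const_mul c
    have h3 := (hD x y hx hy).Ici_of_Ioi.sub h2.hasDerivWithinAt
    have h4 : D x y - c * (Real.log (x + y) + 1 - (Real.log x + 1)) = 0 := by
      rw [hDlog x y hx hy]; ring
    rw [h4] at h3
    exact h3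
  have hGcont : ∀ y, 0 < y → ContinuousOn (fun t => G t y) (Set.Ioi 0) := by
    intro y hy
    have h1 : ContinuousOn (fun t => F t y) (Set.Ioi 0) := (hconc y hy).continuousOn isOpen_Ioi
    refine h1.sub (continuousOn_const.mul (((ContinuousOn.mul (by fun_prop) ?_).sub ?_).sub
      continuousOn_const))
    · exact ContinuousOn.log (by fun_prop) fun t ht => by
        have : 0 < t := ht
        positivity
    · exact Real.continuous_mul_log.continuousOn
  have hGle : ∀ y a b, 0 < y → 0 < a → a ≤ b → G b y = G a y := by
    intro y a b hy ha hab
    exact constant_of_has_deriv_right_zero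
      ((hGcont y hy).mono fun t ht => lt_of_lt_of_le ha ht.1)
      (fun t ht => hGderiv t y (lt_of_lt_of_le ha ht.1) hy) b ⟨hab, le_rfl⟩
  have hGconst : ∀ y a b, 0 < y → 0 < a → 0 < b → G b y = G a y := by
    intro y a b hy ha hb
    rcases le_total a b with h | h
    · exact hGle y a b hy ha h
    · exact (hGle y b a hy hb h).symm
  have hGsymm : ∀ x y, 0 < x → 0 < y → G x y = G y x := by
    intro x y hx hy
    simp only [hG, hsymm x y hx hy, add_comm x y]
    ring
  -- By symmetry G is constant in both variables; being homogeneous of degree 1, it must then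
  -- vanish.
  have hG22 : G 2 2 = 2 * G 1 1 := by
    have h := hhom 2 1 1 two_pos one_pos one_pos
    have h4 : Real.log (2 + 2) = 2 * Real.log 2 := by
      rw [show (2 : ℝ) + 2 = 2 ^ 2 by norm_num, Real.log_pow]; norm_num
    have h2 : Real.log (1 + 1) = Real.log 2 := by norm_num
    simp only [mul_one] at h
    simp only [hG, h, h4, h2, Real.log_one]
    ring
  have hG0 : ∀ x y, 0 < x → 0 < y → G x y = 0 := by
    intro x y hx hy
    have h11 : ∀ x y, 0 < x → 0 < y → G x y = G 1 1 := fun x y hx hy => by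
      rw [hGconst y 1 x hy one_pos hx, hGsymm 1 y one_pos hy, hGconst 1 1 y one_pos one_pos hy]
    have := h11 2 2 two_pos two_pos
    rw [h11 x y hx hy]; linarith
  have hF : ∀ x y, 0 < x → 0 < y →
      F x y = c * ((x + y) * Real.log (x + y) - x * Real.log x - y * Real.log y) :=
    fun x y hx hy => sub_eq_zero.1 (hG0 x y hx hy)
  refine ⟨c, ?_, hF⟩
  have h1 := hF 1 1 one_pos one_pos
  have h2 := hnonneg 1 1 one_pos one_pos
  have h3 : (1 : ℝ) + 1 = 2 := by norm_num
  rw [h1, h3, Real.log_one] at h2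
  have h4 : 0 < Real.log 2 := Real.log_pos one_lt_two
  nlinarith

/-! ### Sufficiency invariant functionals on the cone -/

section Cone

variable {n : ℕ}

/-- A functional on the nonnegative cone that is positively homogeneous, superadditive, vanishes at
the vertices, and whose superadditivity defect is preserved by sufficient transformations. -/
structure IsSufficiencyInvariant (V : (Fin n → ℝ) → ℝ) : Prop where
  smul : ∀ (c : ℝ) (p : Fin n → ℝ), 0 ≤ c → 0 ≤ p → V (c • p) = c * V p
  add_le : ∀ p q : Fin n → ℝ, 0 ≤ p → 0 ≤ q → V p + V q ≤ V (p + q)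
  nonneg : ∀ p : Fin n → ℝ, 0 ≤ p → 0 ≤ V p
  vertex : ∀ x, V (Pi.single x 1) = 0
  -- Here p and q are the masses of X on two values of Y, and p', q' those of T. `K` generates T
  -- from X and `R` generates X from T; the two factorisations describe the same joint law.
  defect : ∀ (K R : Fin n → Fin n → ℝ) (p q p' q' : Fin n → ℝ),
    0 ≤ K → 0 ≤ R → (∀ x, ∑ t, K x t = 1) → (∀ t, ∑ x, R t x = 1) →
    0 ≤ p → 0 ≤ q → 0 ≤ p' → 0 ≤ q' →
    (∀ x t, p x * K x t = p' t * R t x) → (∀ x t, q x * K x t = q' t * R t x) →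
    V (p' + q') - V p' - V q' = V (p + q) - V p - V q

/-- An additive, positively homogeneous function on the nonnegative cone is determined by its
values at the vertices. -/
lemma eq_sum_of_additive {D : (Fin n → ℝ) → ℝ}
    (hadd : ∀ p q : Fin n → ℝ, 0 ≤ p → 0 ≤ q → D (p + q) = D p + D q)
    (hsmul : ∀ (c : ℝ) (p : Fin n → ℝ), 0 ≤ c → 0 ≤ p → D (c • p) = c * D p)
    {p : Fin n → ℝ} (hp : 0 ≤ p) : D p = ∑ x, p x * D (Pi.single x 1) := by
  have hsingle : ∀ x, 0 ≤ (Pi.single x 1 : Fin n → ℝ) := fun x => by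
    rw [Pi.single_nonneg]; exact zero_le_one
  have key : ∀ s : Finset (Fin n), D (∑ x ∈ s, p x • Pi.single x 1) =
      ∑ x ∈ s, p x * D (Pi.single x 1) := by
    intro s
    induction s using Finset.induction_on with
    | empty => simpa using hsmul 0 0 le_rfl le_rfl
    | insert a s ha ih =>
      rw [Finset.sum_insert ha, Finset.sum_insert ha,
        hadd _ _ (smul_nonneg (hp a) (hsingle a))
          (Finset.sum_nonneg fun x _ => smul_nonneg (hp x) (hsingle x)),
        hsmul _ _ (hp a) (hsingle a), ih]
  rw [← key]
  congr 1
  ext y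
  simp [Finset.sum_apply, Pi.single_apply]

/-- Move the mass of `j` to `i`. -/
def merge (i j : Fin n) (p : Fin n → ℝ) : Fin n → ℝ :=
  fun x => if x = i then p i + p j else if x = j then 0 else p x

/-- Distribute the mass of `i` among `i` and `j` in the proportion `α : 1 - α`. -/
def split (i j : Fin n) (α : ℝ) (p : Fin n → ℝ) : Fin n → ℝ :=
  fun x => if x = i then α * p i else if x = j then (1 - α) * p i else p x

/-- The vector with entries `a` at `i` and `b` at `j`. -/
def pair (i j : Fin n) (a b : ℝ) : Fin n → ℝ :=
  fun x => if x = i then a else if x = j then b else 0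

lemma merge_nonneg {i j : Fin n} {p : Fin n → ℝ} (hp : 0 ≤ p) : 0 ≤ merge i j p := by
  intro x
  have h1 := hp i
  have h2 := hp j
  have h3 := hp x
  simp only [Pi.zero_apply] at h1 h2 h3
  simp only [merge, Pi.zero_apply]
  split_ifs <;> linarith

lemma split_nonneg {i j : Fin n} {α : ℝ} (h0 : 0 ≤ α) (h1 : α ≤ 1) {p : Fin n → ℝ} (hp : 0 ≤ p) :
    0 ≤ split i j α p := by
  intro x
  simp only [split, Pi.zero_apply]
  split_ifs
  · exact mul_nonneg h0 (hp i)
  · exact mul_nonneg (by linarith) (hp i)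
  · exact hp x

lemma pair_nonneg {i j : Fin n} {a b : ℝ} (ha : 0 ≤ a) (hb : 0 ≤ b) : 0 ≤ pair i j a b := by
  intro x
  simp only [pair, Pi.zero_apply]
  split_ifs <;> first | assumption | exact le_rfl

lemma merge_add (i j : Fin n) (p q : Fin n → ℝ) :
    merge i j (p + q) = merge i j p + merge i j q := by
  ext x
  simp only [merge, Pi.add_apply]
  split_ifs <;> ring

lemma merge_smul (i j : Fin n) (c : ℝ) (p : Fin n → ℝ) : merge i j (c • p) = c • merge i j p := by
  ext x
  simp only [merge, Pi.smul_apply, smul_eq_mul]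
  split_ifs <;> ring

lemma split_add (i j : Fin n) (α : ℝ) (p q : Fin n → ℝ) :
    split i j α (p + q) = split i j α p + split i j α q := by
  ext x
  simp only [split, Pi.add_apply]
  split_ifs <;> ring

lemma split_smul (i j : Fin n) (α c : ℝ) (p : Fin n → ℝ) :
    split i j α (c • p) = c • split i j α p := by
  ext x
  simp only [split, Pi.smul_apply, smul_eq_mul]
  split_ifs <;> ring

lemma smul_pair (i j : Fin n) (c a b : ℝ) : c • pair i j a b = pair i j (c * a) (c * b) := by
  ext x
  simp only [pair, Pi.smul_apply, smul_eq_mul]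
  split_ifs <;> ring

lemma pair_add (i j : Fin n) (a b a' b' : ℝ) :
    pair i j a b + pair i j a' b' = pair i j (a + a') (b + b') := by
  ext x
  simp only [pair, Pi.add_apply]
  split_ifs <;> ring

namespace IsSufficiencyInvariant

variable {V : (Fin n → ℝ) → ℝ}

lemma zero (hV : IsSufficiencyInvariant V) : V 0 = 0 := by
  simpa using hV.smul 0 0 le_rfl le_rfl

/-- A relabelling is sufficient, with deterministic channels both ways. Hence V(p ∘ σ) − V(p) is
additive in p, and it vanishes at the vertices. -/
lemma comp_perm (hV : IsSufficiencyInvariant V) (σ : Equiv.Perm (Fin n)) {p : Fin n → ℝ}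
    (hp : 0 ≤ p) : V (p ∘ σ) = V p := by
  have hK : ∀ x t : Fin n, (0 : ℝ) ≤ if σ t = x then 1 else 0 := fun x t => by
    split_ifs <;> norm_num
  have h := eq_sum_of_additive (D := fun p => V (p ∘ σ) - V p)
    (fun p q hp hq => by
      have h := hV.defect (fun x t => if σ t = x then 1 else 0)
        (fun t x => if σ t = x then 1 else 0) p q (p ∘ σ) (q ∘ σ)
        hK (fun t x => hK x t)
        (fun x => by
          have : ∀ t, (σ t = x) ↔ (t = σ.symm x) := fun t => by
            rw [Equiv.eq_symm_apply]
          simp [this]) (fun t => by simp) hp hq (fun t => hp (σ t)) (fun t => hq (σ t))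
        (fun x t => by by_cases h : σ t = x <;> simp [h])
        (fun x t => by by_cases h : σ t = x <;> simp [h])
      have h2 : (p + q) ∘ σ = p ∘ σ + q ∘ σ := rfl
      simp only [h2]; linarith)
    (fun c p hc hp => by
      have h2 : (c • p) ∘ σ = c • (p ∘ σ) := rfl
      simp only [h2]
      rw [hV.smul c p hc hp, hV.smul c (p ∘ σ) hc (fun t => hp (σ t))]; ring) hp
  have h0 : ∀ x, V ((Pi.single x 1 : Fin n → ℝ) ∘ σ) = 0 := fun x => by
    have : (Pi.single x 1 : Fin n → ℝ) ∘ σ = Pi.single (σ.symm x) 1 := by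
      ext t
      simp [Pi.single_apply, Equiv.eq_symm_apply]
    rw [this, hV.vertex]
  simp only [h0, hV.vertex] at h
  simp only [sub_self, mul_zero, Finset.sum_const_zero] at h
  linarith

lemma pair_congr (hV : IsSufficiencyInvariant V) {i j i' j' : Fin n} (hij : i ≠ j)
    (hij' : i' ≠ j') {a b : ℝ} (ha : 0 ≤ a) (hb : 0 ≤ b) :
    V (pair i j a b) = V (pair i' j' a b) := by
  obtain ⟨σ, hi, hj⟩ : ∃ σ : Equiv.Perm (Fin n), σ i = i' ∧ σ j = j' := by
    refine ⟨Equiv.swap (Equiv.swap i i' j) j' * Equiv.swap i i', ?_, ?_⟩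
    · rw [Equiv.Perm.mul_apply, Equiv.swap_apply_left]
      refine Equiv.swap_apply_of_ne_of_ne (fun h => hij ?_) hij'
      exact (Equiv.swap i i').injective (by rw [← h, Equiv.swap_apply_left])
    · rw [Equiv.Perm.mul_apply, Equiv.swap_apply_left]
  rw [← hV.comp_perm σ (pair_nonneg (i := i') (j := j') ha hb)]
  congr 1
  ext x
  simp only [pair, Function.comp_apply, ← hi, ← hj, σ.injective.eq_iff]

/-- Splitting the merged letter in a fixed random proportion is undone by merging, so it is
sufficient. The resulting increment of V is additive in p: the vertices i and j each contribute the
value of the pair, the others nothing. -/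
lemma split_merge (hV : IsSufficiencyInvariant V) {i j : Fin n} (hij : i ≠ j) {α : ℝ}
    (h0 : 0 ≤ α) (h1 : α ≤ 1) {p : Fin n → ℝ} (hp : 0 ≤ p) :
    V (split i j α (merge i j p)) =
      V (merge i j p) + (p i + p j) * V (pair i j α (1 - α)) := by
  have h1' : 0 ≤ 1 - α := by linarith
  -- Letter j has no mass after merging, so it is harmless that the forward channel fixes j while
  -- the backward one sends j to i.
  have hchan : ∀ p : Fin n → ℝ, ∀ x t,
      merge i j p x * (if x = i then (if t = i then α else if t = j then 1 - α else 0)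
        else if t = x then 1 else 0) =
      split i j α (merge i j p) t * (if t = j then (if x = i then 1 else 0)
        else if x = t then 1 else 0) := by
    intro p x t
    simp only [merge, split]
    grind
  have h := eq_sum_of_additive (D := fun p => V (split i j α (merge i j p)) - V (merge i j p))
    (fun p q hp hq => by
      have h := hV.defect
        (fun x t => if x = i then (if t = i then α else if t = j then 1 - α else 0)
          else if t = x then 1 else 0)
        (fun t x => if t = j then (if x = i then 1 else 0) else if x = t then 1 else 0)
        (merge i j p) (merge i j q) (split i j α (merge i j p)) (split i j α (merge i j q))
        (fun x t => by simp only [Pi.zero_apply]; split_ifs <;> linarith)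
        (fun x t => by simp only [Pi.zero_apply]; split_ifs <;> linarith)
        (fun x => by
          by_cases hx : x = i
          · have : ∀ t, (if t = i then α else if t = j then 1 - α else 0) =
                (if t = i then α else 0) + (if t = j then 1 - α else 0) := by
              intro t; grind
            simp [hx, this, Finset.sum_add_distrib]
          · simp [hx])
        (fun t => by by_cases ht : t = j <;> simp [ht])
        (merge_nonneg hp) (merge_nonneg hq) (split_nonneg h0 h1 (merge_nonneg hp))
        (split_nonneg h0 h1 (merge_nonneg hq)) (hchan p) (hchan q)
      simp only [merge_add, split_add]; linarith)
    (fun c p hc hp => by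
      simp only [merge_smul, split_smul]
      rw [hV.smul c _ hc (merge_nonneg hp),
        hV.smul c _ hc (split_nonneg h0 h1 (merge_nonneg hp))]; ring) hp
  have hmi : ∀ x, x = i ∨ x = j → merge i j (Pi.single x 1 : Fin n → ℝ) = Pi.single i 1 := by
    intro x hx; ext t; simp only [merge, Pi.single_apply]; grind
  have hsi : split i j α (Pi.single i 1) = pair i j α (1 - α) := by
    ext t; simp only [split, pair, Pi.single_apply]; grind
  have hm : ∀ x, x ≠ i → x ≠ j → merge i j (Pi.single x 1 : Fin n → ℝ) = Pi.single x 1 := by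
    intro x hi hj; ext t; simp only [merge, Pi.single_apply]; grind
  have hs : ∀ x, x ≠ i → x ≠ j → split i j α (Pi.single x 1 : Fin n → ℝ) = Pi.single x 1 := by
    intro x hi hj; ext t; simp only [split, Pi.single_apply]; grind
  have hval : ∀ x, p x * (V (split i j α (merge i j (Pi.single x 1 : Fin n → ℝ))) -
      V (merge i j (Pi.single x 1 : Fin n → ℝ))) =
      (if x = i then p i * V (pair i j α (1 - α)) else 0) +
      (if x = j then p j * V (pair i j α (1 - α)) else 0) := by
    intro x
    by_cases hi : x = i
    · subst hi
      rw [hmi x (Or.inl rfl), hsi, hV.vertex]; simp [hij]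
    · by_cases hj : x = j
      · subst hj
        rw [hmi x (Or.inr rfl), hsi, hV.vertex]; simp [hi]
      · rw [hm x hi hj, hs x hi hj]; simp [hi, hj]
  simp only [hval, Finset.sum_add_distrib, Finset.sum_ite_eq', Finset.mem_univ, if_true] at h
  linarith

/-- The chain rule: merging two letters costs the value of the pair. -/
lemma eq_merge_add (hV : IsSufficiencyInvariant V) {i j : Fin n} (hij : i ≠ j) {p : Fin n → ℝ}
    (hp : 0 ≤ p) : V p = V (merge i j p) + V (pair i j (p i) (p j)) := by
  have hi : 0 ≤ p i := hp i
  have hj : 0 ≤ p j := hp j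
  rcases (add_nonneg hi hj).lt_or_eq with hs | hs
  -- With this proportion the split undoes the merge, and homogeneity absorbs the factor p i + p j.
  · have h := hV.split_merge hij (α := p i / (p i + p j)) (by positivity)
      ((div_le_one hs).2 (by linarith)) hp
    have hα : 1 - p i / (p i + p j) = p j / (p i + p j) := by field_simp; ring
    have hpair : 0 ≤ pair i j (p i / (p i + p j)) (p j / (p i + p j)) :=
      pair_nonneg (by positivity) (by positivity)
    rw [hα, ← hV.smul _ _ hs.le hpair, smul_pair, mul_div_cancel₀ _ hs.ne',
      mul_div_cancel₀ _ hs.ne'] at h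
    rw [← h]
    congr 1
    ext x
    simp only [split, merge]
    by_cases hxi : x = i
    · subst hxi; simp [hs.ne']
    · by_cases hxj : x = j
      · subst hxj; simp only [if_neg hxi, if_true, hα]; field_simp
      · simp [hxi, hxj]
  · have hi0 : p i = 0 := by linarith
    have hj0 : p j = 0 := by linarith
    have h1 : merge i j p = p := by
      ext x; simp only [merge]; grind
    have h2 : pair i j (p i) (p j) = 0 := by
      ext x; simp [pair, hi0, hj0]
    rw [h1, h2, hV.zero, add_zero]

lemma pair_zero_right (hV : IsSufficiencyInvariant V) {i j : Fin n} {a : ℝ}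
    (ha : 0 ≤ a) : V (pair i j a 0) = 0 := by
  have h : pair i j a 0 = a • Pi.single i 1 := by
    ext x; simp [pair, Pi.single_apply]
  rw [h, hV.smul _ _ ha (by rw [Pi.single_nonneg]; exact zero_le_one), hV.vertex, mul_zero]

lemma pair_comm (hV : IsSufficiencyInvariant V) {i j : Fin n} (hij : i ≠ j) {a b : ℝ}
    (ha : 0 ≤ a) (hb : 0 ≤ b) : V (pair i j a b) = V (pair i j b a) := by
  rw [hV.pair_congr hij hij.symm ha hb]
  congr 1
  ext x; simp only [pair]; grind

/-- Both sides are what the chain rule leaves of V(x, y, z) after cancelling the full merger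
differently: merge i and j first, or j and k first. This needs three distinct letters. -/
lemma pair_cocycle (hV : IsSufficiencyInvariant V) {i j k : Fin n} (hij : i ≠ j) (hjk : j ≠ k)
    (hik : i ≠ k) {x y z : ℝ} (hx : 0 ≤ x) (hy : 0 ≤ y) (hz : 0 ≤ z) :
    V (pair i j (x + y) z) + V (pair i j x y) = V (pair i j x (y + z)) + V (pair i j y z) := by
  set p : Fin n → ℝ := fun t => if t = i then x else if t = j then y else if t = k then z else 0
    with hpdef
  have hp : 0 ≤ p := by
    intro t
    simp only [hpdef, Pi.zero_apply]
    split_ifs <;> first | assumption | exact le_rfl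
  have hpi : p i = x := by simp [hpdef]
  have hpj : p j = y := by simp [hpdef, hij.symm]
  have hpk : p k = z := by simp [hpdef, hik.symm, hjk.symm]
  have h1 := hV.eq_merge_add hij hp
  have h2 := hV.eq_merge_add hjk hp
  have hm1 : merge i j p = pair i k (x + y) z := by
    ext t; simp only [merge, pair, hpi, hpj]; grind
  have hm2 : merge j k p = pair i j x (y + z) := by
    ext t; simp only [merge, pair, hpj, hpk]; grind
  rw [hm1, hpi, hpj, hV.pair_congr hik hij (add_nonneg hx hy) hz] at h1
  rw [hm2, hpj, hpk, hV.pair_congr hjk hij hy hz] at h2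
  linarith

lemma pair_eq (hn : 3 ≤ n) (hV : IsSufficiencyInvariant V) :
    ∃ c : ℝ, 0 ≤ c ∧ ∀ (i j : Fin n) (a b : ℝ), i ≠ j → 0 ≤ a → 0 ≤ b →
      V (pair i j a b) = c * ((a + b) * Real.log (a + b) - a * Real.log a - b * Real.log b) := by
  obtain ⟨i, j, k, hij, hjk, hik⟩ : ∃ i j k : Fin n, i ≠ j ∧ j ≠ k ∧ i ≠ k :=
    ⟨⟨0, by omega⟩, ⟨1, by omega⟩, ⟨2, by omega⟩, by simp, by simp, by simp⟩
  obtain ⟨c, hc, h⟩ := cocycle_eq_entropy (F := fun a b => V (pair i j a b))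
    (fun x y hx hy => hV.pair_comm hij hx.le hy.le)
    (fun c x y hc hx hy => by
      simp only [← smul_pair]
      exact hV.smul _ _ hc.le (pair_nonneg hx.le hy.le))
    -- Homogeneity and superadditivity give concavity; the second entry stays y because a + b = 1.
    (fun y hy => by
      refine ⟨convex_Ioi 0, fun x hx x' hx' a b ha hb hab => ?_⟩
      have hx0 : 0 ≤ x := le_of_lt hx
      have hx0' : 0 ≤ x' := le_of_lt hx'
      have h := hV.add_le (a • pair i j x y) (b • pair i j x' y)
        (smul_nonneg ha (pair_nonneg hx0 hy.le)) (smul_nonneg hb (pair_nonneg hx0' hy.le))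
      rw [hV.smul _ _ ha (pair_nonneg hx0 hy.le), hV.smul _ _ hb (pair_nonneg hx0' hy.le),
        smul_pair, smul_pair, pair_add, ← add_mul, hab, one_mul] at h
      simpa using h)
    (fun x y z hx hy hz => hV.pair_cocycle hij hjk hik hx.le hy.le hz.le)
    (fun x y hx hy => hV.nonneg _ (pair_nonneg hx.le hy.le))
  refine ⟨c, hc, fun i' j' a b hij' ha hb => ?_⟩
  rw [hV.pair_congr hij' hij ha hb]
  -- The cocycle theorem covers positive entries only; on the boundary both sides vanish, with 0 log
  -- 0 = 0.
  rcases ha.lt_or_eq with ha' | rfl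
  · rcases hb.lt_or_eq with hb' | rfl
    · exact h a b ha' hb'
    · rw [hV.pair_zero_right ha]; simp
  · rw [hV.pair_comm hij le_rfl hb, hV.pair_zero_right hb]; simp

/-- A sufficiency invariant functional is a multiple of the homogeneous extension of entropy. -/
theorem eq_entropy (hn : 3 ≤ n) (hV : IsSufficiencyInvariant V) :
    ∃ c : ℝ, 0 ≤ c ∧ ∀ p : Fin n → ℝ, 0 ≤ p →
      V p = c * ((∑ x, p x) * Real.log (∑ x, p x) - ∑ x, p x * Real.log (p x)) := by
  obtain ⟨c, hc, hpair⟩ := hV.pair_eq hn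
  refine ⟨c, hc, ?_⟩
  -- Induction on the size of the support: merging two letters of positive mass removes one, and a
  -- vector with at most one nonzero entry gives 0 on both sides.
  suffices H : ∀ (N : ℕ) (p : Fin n → ℝ), 0 ≤ p → (Finset.univ.filter fun x => p x ≠ 0).card ≤ N →
      V p = c * ((∑ x, p x) * Real.log (∑ x, p x) - ∑ x, p x * Real.log (p x)) from
    fun p hp => H _ p hp le_rfl
  intro N
  induction N with
  | zero =>
    intro p hp hN
    have h0 : p = 0 := by
      ext x
      have := Finset.card_eq_zero.1 (Nat.le_zero.1 hN)
      simpa using Finset.filter_eq_empty_iff.1 this (Finset.mem_univ x)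
    simp [h0, hV.zero]
  | succ N ih =>
    intro p hp hN
    by_cases hex : ∃ i j, i ≠ j ∧ p i ≠ 0 ∧ p j ≠ 0
    · obtain ⟨i, j, hij, hi, hj⟩ := hex
      have hi' : 0 < p i := lt_of_le_of_ne (hp i) hi.symm
      have hj' : 0 < p j := lt_of_le_of_ne (hp j) hj.symm
      have hsum : ∀ f : ℝ → ℝ, f 0 = 0 → ∑ x, f (merge i j p x) =
          ∑ x, f (p x) + f (p i + p j) - f (p i) - f (p j) := by
        intro f hf
        have : ∀ x, f (merge i j p x) = f (p x) + (if x = i then f (p i + p j) - f (p i) else 0) -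
            (if x = j then f (p j) else 0) := by
          intro x
          by_cases h1 : x = i
          · subst h1; simp [merge, hij]
          · by_cases h2 : x = j
            · subst h2; simp [merge, h1, hf]
            · simp [merge, h1, h2]
        simp only [this, Finset.sum_add_distrib, Finset.sum_sub_distrib, Finset.sum_ite_eq',
          Finset.mem_univ, if_true]
        ring
      have hcard : (Finset.univ.filter fun x => merge i j p x ≠ 0).card ≤ N := by
        refine Nat.lt_succ_iff.1 (lt_of_lt_of_le (Finset.card_lt_card ?_) hN)
        refine Finset.ssubset_iff_subset_ne.2 ⟨fun x hx => ?_, fun h => ?_⟩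
        · simp only [Finset.mem_filter, Finset.mem_univ, true_and, merge] at hx ⊢
          grind
        · have : j ∈ Finset.univ.filter fun x => merge i j p x ≠ 0 := by
            rw [h]; simpa using hj
          have h2 := (Finset.mem_filter.1 this).2
          simp [merge, hij.symm] at h2
      have h1 := hsum id rfl
      have h2 := hsum (fun t => t * Real.log t) (by simp)
      simp only [id] at h1
      have h1' : ∑ x, merge i j p x = ∑ x, p x := by linarith
      rw [hV.eq_merge_add hij hp, ih _ (merge_nonneg hp) hcard,
        hpair i j _ _ hij hi'.le hj'.le, h1', h2]
      ring
    · push Not at hex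
      by_cases hz : ∃ i, p i ≠ 0
      · obtain ⟨i, hi⟩ := hz
        have hpi : p = p i • Pi.single i 1 := by
          ext x
          by_cases hx : x = i
          · subst hx; simp
          · simp [hx, hex i x (Ne.symm hx) hi]
        have h0 : ∀ x, x ≠ i → p x = 0 := fun x hx => hex i x (Ne.symm hx) hi
        rw [Finset.sum_eq_single i (fun x _ hx => h0 x hx) (by simp),
          Finset.sum_eq_single i (fun x _ hx => by simp [h0 x hx]) (by simp), sub_self, mul_zero,
          hpi, hV.smul _ _ (hp i) (by rw [Pi.single_nonneg]; exact zero_le_one), hV.vertex,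
          mul_zero]
      · push Not at hz
        have : p = 0 := funext hz
        simp [this, hV.zero]

end IsSufficiencyInvariant

end Cone

/-! ### Extended-real expectations -/

lemma coe_add_iInf {ι : Sort*} (r : ℝ) (f : ι → ℝ≥0∞) :
    (r : EReal) + ((⨅ i, f i : ℝ≥0∞) : EReal) = ⨅ i, ((r : EReal) + (f i : EReal)) := by
  apply le_antisymm
  · exact le_iInf fun i => add_le_add le_rfl (EReal.coe_ennreal_le_coe_ennreal_iff.2 (iInf_le _ _))
  · set b := ⨅ i, ((r : EReal) + (f i : EReal)) with hb
    have h1 : ∀ i, (b - r).toENNReal ≤ f i := fun i => by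
      rw [← EReal.toENNReal_coe (x := f i)]
      refine EReal.toENNReal_le_toENNReal (EReal.sub_le_of_le_add' ?_)
      exact iInf_le _ i
    have h2 : b - r ≤ ((⨅ i, f i : ℝ≥0∞) : EReal) :=
      (le_max_right 0 _).trans (EReal.coe_toENNReal_eq_max (x := b - r) ▸
        EReal.coe_ennreal_le_coe_ennreal_iff.2 (le_iInf h1))
    have h3 := (EReal.sub_le_iff_le_add (Or.inl (EReal.coe_ne_bot r))
      (Or.inl (EReal.coe_ne_top r))).1 h2
    rwa [add_comm] at h3

/-- For x = m + e this is x⁺ − x⁻ = m⁺ − m⁻ + e rearranged without subtraction, so that it survives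
e = ∞ and can be integrated in `ℝ≥0∞`. -/
lemma toENNReal_add_ofReal_neg (m : ℝ) (e : ℝ≥0∞) :
    ((m : EReal) + e).toENNReal + ENNReal.ofReal (-m) =
      (-((m : EReal) + e)).toENNReal + ENNReal.ofReal m + e := by
  induction e with
  | top => simp
  | coe r =>
    have h : (m : EReal) + ((r : ℝ≥0∞) : EReal) = ((m + r : ℝ) : EReal) := by
      rw [EReal.coe_add]; rfl
    rw [h, ← EReal.coe_neg, EReal.real_coe_toENNReal, EReal.real_coe_toENNReal,
      ← ENNReal.ofReal_coe_nnreal]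
    have hr : (0 : ℝ) ≤ r := r.2
    rw [← ENNReal.toReal_eq_toReal_iff' (by simp) (by simp), ENNReal.toReal_add (by simp) (by simp),
      ENNReal.toReal_add (by simp) (by simp), ENNReal.toReal_add (by simp) (by simp)]
    simp only [ENNReal.toReal_ofReal']
    rcases max_cases (m + r) 0 with h1 | h1 <;> rcases max_cases (-m) 0 with h2 | h2 <;>
      rcases max_cases (-(m + r)) 0 with h3 | h3 <;> rcases max_cases m 0 with h4 | h4 <;>
      rw [h1.1, h2.1, h3.1, h4.1, max_eq_left hr] <;> linarith

lemma coe_sub_coe_eq {P N a b E : ℝ≥0∞} (hN : N ≠ ⊤) (ha : a ≠ ⊤) (hb : b ≠ ⊤)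
    (h : P + b = N + a + E) :
    (P : EReal) - N = ((a.toReal - b.toReal : ℝ) : EReal) + E := by
  lift N to NNReal using hN
  lift a to NNReal using ha
  lift b to NNReal using hb
  induction E with
  | top =>
    have hP : P = ⊤ := by simpa using h
    subst hP
    rw [EReal.coe_ennreal_top, EReal.add_top_of_ne_bot (EReal.coe_ne_bot _)]
    exact EReal.top_sub_coe (N : ℝ)
  | coe r =>
    have hP : P ≠ ⊤ := by
      rintro rfl
      simp at h
      exact absurd h (by exact_mod_cast ENNReal.top_ne_coe (r := N + a + r))
    lift P to NNReal using hP
    have h' : (P : ℝ) + b = N + a + r := by exact_mod_cast h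
    change ((P : ℝ) : EReal) - ((N : ℝ) : EReal) = (((a : ℝ) - b : ℝ) : EReal) + ((r : ℝ) : EReal)
    rw [← EReal.coe_sub, ← EReal.coe_add]
    congr 1
    linarith

/-- The negative part of m + e is at most that of m, which has finite integral, so no indeterminate
form arises even if e has infinite integral. -/
lemma expect_coe_add {Ω : Type*} [MeasurableSpace Ω] (μ : Measure Ω) {m : Ω → ℝ} {e : Ω → ℝ≥0∞}
    (hm : Integrable m μ) (hmm : Measurable m) (he : Measurable e) :
    expect μ (fun ω => (m ω : EReal) + e ω) =
      ((∫ ω, m ω ∂μ : ℝ) : EReal) + ((∫⁻ ω, e ω ∂μ : ℝ≥0∞) : EReal) := by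
  have hf : Measurable fun ω => (m ω : EReal) + (e ω : EReal) :=
    hmm.coe_real_ereal.add he.coe_ereal_ennreal
  have hpos : ∫⁻ ω, ENNReal.ofReal (m ω) ∂μ ≠ ⊤ := hm.lintegral_lt_top.ne
  have hneg : ∫⁻ ω, ENNReal.ofReal (-m ω) ∂μ ≠ ⊤ := hm.neg.lintegral_lt_top.ne
  have hN : ∫⁻ ω, (-((m ω : EReal) + e ω)).toENNReal ∂μ ≠ ⊤ := by
    refine ne_top_of_le_ne_top hneg (lintegral_mono fun ω => ?_)
    rw [← EReal.real_coe_toENNReal, EReal.coe_neg]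
    refine EReal.toENNReal_le_toENNReal (EReal.neg_le_neg_iff.2 ?_)
    exact le_add_of_nonneg_right (EReal.coe_ennreal_nonneg _)
  have key : ∫⁻ ω, ((m ω : EReal) + e ω).toENNReal ∂μ + ∫⁻ ω, ENNReal.ofReal (-m ω) ∂μ =
      ∫⁻ ω, (-((m ω : EReal) + e ω)).toENNReal ∂μ + ∫⁻ ω, ENNReal.ofReal (m ω) ∂μ +
        ∫⁻ ω, e ω ∂μ := by
    rw [← lintegral_add_right _ (by fun_prop), ← lintegral_add_right _ (by fun_prop),
      ← lintegral_add_right _ he]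
    exact lintegral_congr fun ω => toENNReal_add_ofReal_neg _ _
  rw [integral_eq_lintegral_pos_part_sub_lintegral_neg_part hm]
  exact coe_sub_coe_eq hN hpos hneg key

/-! ### The Bayes functional -/

section Bayes

variable {n : ℕ} {A : Type*}

/-- The minimal weighted excess loss of a constant action. -/
noncomputable def bayes (e : Fin n → A → ℝ≥0∞) (p : Fin n → ℝ≥0∞) : ℝ≥0∞ := ⨅ a, ∑ x, p x * e x a

lemma bayes_ne_top {e : Fin n → A → ℝ≥0∞} (he : ∃ a, ∀ x, e x a ≠ ⊤) {p : Fin n → ℝ≥0∞}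
    (hp : ∀ x, p x ≠ ⊤) : bayes e p ≠ ⊤ := by
  obtain ⟨a, ha⟩ := he
  exact ne_top_of_le_ne_top
    (ENNReal.sum_ne_top.2 fun x _ => ENNReal.mul_ne_top (hp x) (ha x)) (iInf_le _ a)

/-- Countably many actions suffice to compute `bayes`. -/
lemma exists_seq_bayes_eq [Nonempty A] (e : Fin n → A → ℝ≥0∞) :
    ∃ a : ℕ → A, ∀ p : Fin n → ℝ≥0∞, (∀ x, p x ≠ ⊤) →
      bayes e p = ⨅ k, ∑ x, p x * e x (a k) := by
  -- Density is taken among the excess vectors in `Fin n → ℝ≥0∞`, so no topology on `A` is needed.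
  have : Nonempty (Set.range fun a x => e x a) := (Set.range_nonempty _).to_subtype
  obtain ⟨u, hu⟩ := TopologicalSpace.exists_dense_seq (Set.range fun a x => e x a)
  choose a ha using fun k => (u k).2
  refine ⟨a, fun p hp => le_antisymm (le_iInf fun k => iInf_le _ _) (le_iInf fun b => ?_)⟩
  refine le_of_forall_gt fun r hr => ?_
  have hcont : Continuous fun v : Set.range fun a x => e x a => ∑ x, p x * v.1 x :=
    continuous_finsetSum _ fun x _ =>
      (ENNReal.continuous_const_mul (hp x)).comp
        ((continuous_apply x).comp continuous_subtype_val)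
  obtain ⟨k, hk⟩ := hu.exists_mem_open (isOpen_Iio.preimage hcont) ⟨⟨_, b, rfl⟩, hr⟩
  refine lt_of_le_of_lt (iInf_le _ k) ?_
  have h := hk
  simp only [Set.mem_preimage, Set.mem_Iio, ← ha k] at h
  exact h

end Bayes

/-! ### Normalisation of the loss and formulas for the risk -/

section Loss

variable {n : ℕ} {A : Type*} [MeasurableSpace A]

lemma risk_eq_riskGiven_const {Ω 𝒮 : Type*} [MeasurableSpace Ω] [MeasurableSpace 𝒮]
    (ℓ : Fin n → A → EReal) (μ : Measure Ω) (X : Ω → Fin n) (s : 𝒮) :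
    risk ℓ μ X = riskGiven ℓ μ X (fun _ => s) := by
  apply le_antisymm
  · exact le_iInf fun g => iInf_le _ (g.1 s)
  · exact le_iInf fun a => iInf_le (fun g : {g : 𝒮 → A // Measurable g} =>
      expect μ (fun ω => ℓ (X ω) (g.1 s))) ⟨fun _ => a, measurable_const⟩

/-- For constant Y the two risks coincide, so an infinite value would produce an indeterminate form.
-/
lemma WellDefined.risk_ne {ℓ : Fin n → A → EReal} (hwd : WellDefined ℓ) {Ω : Type}
    [MeasurableSpace Ω] (μ : Measure Ω) [IsProbabilityMeasure μ] {X : Ω → Fin n}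
    (hX : Measurable X) : risk ℓ μ X ≠ ⊤ ∧ risk ℓ μ X ≠ ⊥ := by
  have h := hwd Ω μ 1 X (fun _ => 0) hX measurable_const
  rw [← risk_eq_riskGiven_const] at h
  simpa using h

lemma expect_dirac {Ω : Type*} [MeasurableSpace Ω] [MeasurableSingletonClass Ω] (ω : Ω)
    (f : Ω → EReal) : expect (Measure.dirac ω) f = f ω := by
  simp only [expect, lintegral_dirac]
  rcases le_total 0 (f ω) with h | h
  · rw [EReal.coe_toENNReal h, EReal.toENNReal_of_nonpos (EReal.neg_le_zero.2 h)]
    simp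
  · rw [EReal.toENNReal_of_nonpos h, EReal.coe_toENNReal (EReal.neg_nonneg.2 h)]
    simp

/-- A loss that is a sum of a finite function of the letter and a nonnegative excess which is, for
each letter, arbitrarily small, and for some action finite at all letters. -/
structure IsNormalized (ℓ : Fin n → A → EReal) (m : Fin n → ℝ) (e : Fin n → A → ℝ≥0∞) :
    Prop where
  measurable : ∀ x, Measurable (e x)
  eq_add : ∀ x a, ℓ x a = (m x : EReal) + (e x a : EReal)
  iInf_eq : ∀ x, ⨅ a, e x a = 0
  exists_finite : ∃ a, ∀ x, e x a ≠ ⊤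

lemma measurable_loss_comp {Ω : Type*} [MeasurableSpace Ω]
    {e : Fin n → A → ℝ≥0∞} (he : ∀ x, Measurable (e x)) {X : Ω → Fin n} (hX : Measurable X)
    {g : Ω → A} (hg : Measurable g) : Measurable fun ω => e (X ω) (g ω) := by
  have h : Measurable fun q : A × Fin n => e q.2 q.1 := measurable_from_prod_countable_left he
  exact h.comp (hg.prodMk hX)

/-- The infimum of `ℓ x` is the risk of the deterministic letter x, hence finite. An action of
finite risk for uniform X has finite excess at every letter, since each letter has positive mass. -/
lemma WellDefined.exists_normalization (hn : 0 < n) {ℓ : Fin n → A → EReal}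
    (hmeas : ∀ x, Measurable (ℓ x)) (hwd : WellDefined ℓ) :
    ∃ m e, IsNormalized ℓ m e := by
  have hinf : ∀ x, (⨅ a, ℓ x a) ≠ ⊤ ∧ (⨅ a, ℓ x a) ≠ ⊥ := by
    intro x
    have h := hwd.risk_ne (Measure.dirac ()) (X := fun _ => x) measurable_const
    simpa only [risk, expect_dirac] using h
  set m : Fin n → ℝ := fun x => (⨅ a, ℓ x a).toReal with hm
  have hmc : ∀ x, ((m x : ℝ) : EReal) = ⨅ a, ℓ x a := fun x =>
    EReal.coe_toReal (hinf x).1 (hinf x).2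
  set e : Fin n → A → ℝ≥0∞ := fun x a => (ℓ x a - m x).toENNReal with he
  have hem : ∀ x, Measurable (e x) := fun x =>
    ((hmeas x).add_const (-(m x : EReal))).ereal_toENNReal
  have heq : ∀ x a, ℓ x a = (m x : EReal) + (e x a : EReal) := by
    intro x a
    have h0 : 0 ≤ ℓ x a - m x := by
      rw [EReal.sub_nonneg (by simp) (by simp), hmc]
      exact iInf_le _ a
    rw [he, EReal.coe_toENNReal h0, add_comm, EReal.sub_add_cancel]
  refine ⟨m, e, hem, heq, fun x => ?_, ?_⟩
  · have h := coe_add_iInf (m x) (e x)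
    simp only [← heq, ← hmc] at h
    revert h
    generalize ⨅ a, e x a = E
    intro h
    induction E with
    | top => simp at h
    | coe r =>
      have h' : m x + (r : ℝ) = m x := EReal.coe_injective (by rw [EReal.coe_add]; exact h)
      simpa using h'
  · have : NeZero n := ⟨hn.ne'⟩
    have h := (hwd.risk_ne (ProbabilityTheory.uniformOn (Set.univ : Set (Fin n))) (X := id)
      measurable_id).1
    obtain ⟨a, ha⟩ := iInf_lt_iff.1 (lt_top_iff_ne_top.2 h)
    refine ⟨a, fun x hx => ?_⟩
    simp only [heq, id] at ha
    rw [expect_coe_add _ (Integrable.of_finite) (by fun_prop) (by fun_prop)] at ha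
    have h3 : ∫⁻ x, e x a ∂(ProbabilityTheory.uniformOn (Set.univ : Set (Fin n))) = ⊤ := by
      rw [lintegral_fintype]
      refine ENNReal.sum_eq_top.2 ⟨x, Finset.mem_univ _, ?_⟩
      rw [hx, ENNReal.top_mul]
      rw [ProbabilityTheory.uniformOn_univ]
      simp
    rw [h3] at ha
    simp at ha

lemma IsNormalized.riskGiven_eq {Ω 𝒮 : Type*} [MeasurableSpace Ω] [MeasurableSpace 𝒮]
    {ℓ : Fin n → A → EReal} {m : Fin n → ℝ} {e : Fin n → A → ℝ≥0∞} (h : IsNormalized ℓ m e)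
    (μ : Measure Ω) [IsFiniteMeasure μ] {X : Ω → Fin n} (hX : Measurable X) {S : Ω → 𝒮}
    (hS : Measurable S) :
    riskGiven ℓ μ X S = ((∫ ω, m (X ω) ∂μ : ℝ) : EReal) +
      ((⨅ g : {g : 𝒮 → A // Measurable g}, ∫⁻ ω, e (X ω) (g.1 (S ω)) ∂μ : ℝ≥0∞) : EReal) := by
  rw [coe_add_iInf]
  refine iInf_congr fun g => ?_
  simp only [h.eq_add]
  refine expect_coe_add μ ?_ ?_ (measurable_loss_comp h.measurable hX (g.2.comp hS))
  · have hm : Integrable m (μ.map X) := Integrable.of_finite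
    exact hm.comp_measurable hX
  · exact (measurable_of_finite m).comp hX

/-- Pointwise minimization of the weighted excess loss can be performed by a measurable
estimator, up to an arbitrarily small error. -/
lemma iInf_lintegral_eq_lintegral_bayes {𝒮 : Type*} [MeasurableSpace 𝒮] {e : Fin n → A → ℝ≥0∞}
    (he : ∃ a, ∀ x, e x a ≠ ⊤) (ν : Measure 𝒮) [IsFiniteMeasure ν]
    {κ : 𝒮 → Fin n → ℝ≥0∞} (hκ : ∀ x, Measurable fun s => κ s x) (hfin : ∀ s x, κ s x ≠ ⊤) :
    ⨅ g : {g : 𝒮 → A // Measurable g}, ∫⁻ s, ∑ x, κ s x * e x (g.1 s) ∂ν =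
      ∫⁻ s, bayes e (κ s) ∂ν := by
  have : Nonempty A := ⟨he.choose⟩
  obtain ⟨a, ha⟩ := exists_seq_bayes_eq e
  have hL : ∀ k, Measurable fun s => ∑ x, κ s x * e x (a k) := fun k =>
    Finset.measurable_sum _ fun x _ => (hκ x).mul_const _
  have hB : Measurable fun s => bayes e (κ s) := by
    simp only [fun s => ha (κ s) (hfin s)]
    exact Measurable.iInf hL
  apply le_antisymm
  · refine ENNReal.le_of_forall_pos_le_add fun ε hε _ => ?_
    -- Adding 1 to the denominator covers the case of zero total mass.
    obtain ⟨δ, hδ, hδε⟩ : ∃ δ : ℝ≥0∞, 0 < δ ∧ δ * ν Set.univ ≤ ε := by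
      refine ⟨ε / (ν Set.univ + 1), ENNReal.div_pos (by exact_mod_cast hε.ne') (by simp), ?_⟩
      calc (ε : ℝ≥0∞) / (ν Set.univ + 1) * ν Set.univ
          ≤ ε / (ν Set.univ + 1) * (ν Set.univ + 1) := by gcongr; exact le_self_add
        _ ≤ ε := (ENNReal.div_mul_cancel (by simp) (by simp)).le
    have hex : ∀ s, ∃ k, ∑ x, κ s x * e x (a k) ≤ bayes e (κ s) + δ := by
      intro s
      have h1 : bayes e (κ s) < bayes e (κ s) + δ :=
        ENNReal.lt_add_right (bayes_ne_top he (hfin s)) hδ.ne'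
      conv_lhs at h1 => rw [ha (κ s) (hfin s)]
      obtain ⟨k, hk⟩ := iInf_lt_iff.1 h1
      exact ⟨k, hk.le⟩
    classical
    -- The least index of a δ-optimal action is a measurable function of s.
    have hg : Measurable fun s => a (Nat.find (hex s)) :=
      (measurable_of_countable a).comp (measurable_find hex fun k =>
        measurableSet_le (hL k) (hB.add_const _))
    calc _ ≤ ∫⁻ s, ∑ x, κ s x * e x (a (Nat.find (hex s))) ∂ν := iInf_le
          (fun g : {g : 𝒮 → A // Measurable g} => ∫⁻ s, ∑ x, κ s x * e x (g.1 s) ∂ν) ⟨_, hg⟩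
      _ ≤ ∫⁻ s, (bayes e (κ s) + δ) ∂ν := lintegral_mono fun s => Nat.find_spec (hex s)
      _ = ∫⁻ s, bayes e (κ s) ∂ν + δ * ν Set.univ := by
        rw [lintegral_add_right _ measurable_const, lintegral_const]
      _ ≤ _ := by gcongr
  · exact le_iInf fun g => lintegral_mono fun s => iInf_le _ _

lemma lintegral_loss_eq_sum {Ω : Type*} [MeasurableSpace Ω] (μ : Measure Ω) {k : ℕ}
    {X : Ω → Fin n} (hX : Measurable X) {Y : Ω → Fin k} (hY : Measurable Y)
    (f : Fin n → Fin k → ℝ≥0∞) :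
    ∫⁻ ω, f (X ω) (Y ω) ∂μ = ∑ y, ∑ x, μ {ω | X ω = x ∧ Y ω = y} * f x y := by
  have h := lintegral_map (μ := μ) (f := fun q : Fin n × Fin k => f q.1 q.2)
    (measurable_of_finite _) (hX.prodMk hY)
  rw [← h, lintegral_fintype, Fintype.sum_prod_type, Finset.sum_comm]
  refine Finset.sum_congr rfl fun y _ => Finset.sum_congr rfl fun x _ => ?_
  rw [Measure.map_apply (hX.prodMk hY) (measurableSet_singleton _), mul_comm]
  congr 2
  ext ω
  simp

lemma IsNormalized.riskGiven_finite {Ω : Type*} [MeasurableSpace Ω]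
    {ℓ : Fin n → A → EReal} {m : Fin n → ℝ} {e : Fin n → A → ℝ≥0∞} (h : IsNormalized ℓ m e)
    (μ : Measure Ω) [IsFiniteMeasure μ] {X : Ω → Fin n} (hX : Measurable X) {k : ℕ}
    {Y : Ω → Fin k} (hY : Measurable Y) :
    riskGiven ℓ μ X Y = ((∫ ω, m (X ω) ∂μ : ℝ) : EReal) +
      ((∑ y, bayes e (fun x => μ {ω | X ω = x ∧ Y ω = y}) : ℝ≥0∞) : EReal) := by
  rw [h.riskGiven_eq μ hX hY]
  -- Counting measure with the joint masses as weights avoids conditioning on null values of Y.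
  have h1 := iInf_lintegral_eq_lintegral_bayes h.exists_finite
    (Measure.count : Measure (Fin k)) (κ := fun y x => μ {ω | X ω = x ∧ Y ω = y})
    (fun x => measurable_of_finite _) (fun y x => measure_ne_top μ _)
  simp only [lintegral_count, tsum_fintype] at h1
  rw [← h1]
  congr 3
  ext g
  exact lintegral_loss_eq_sum μ hX hY fun x y => e x (g.1 y)

lemma IsNormalized.risk_eq {Ω : Type*} [MeasurableSpace Ω]
    {ℓ : Fin n → A → EReal} {m : Fin n → ℝ} {e : Fin n → A → ℝ≥0∞} (h : IsNormalized ℓ m e)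
    (μ : Measure Ω) [IsFiniteMeasure μ] {X : Ω → Fin n} (hX : Measurable X) :
    risk ℓ μ X = ((∫ ω, m (X ω) ∂μ : ℝ) : EReal) +
      ((bayes e (fun x => μ {ω | X ω = x}) : ℝ≥0∞) : EReal) := by
  rw [risk_eq_riskGiven_const ℓ μ X (0 : Fin 1), h.riskGiven_finite μ hX measurable_const]
  simp

lemma coe_add_sub_coe_add (r : ℝ) {a b : ℝ≥0∞} (ha : a ≠ ⊤) (hb : b ≠ ⊤) :
    ((r : EReal) + (a : EReal)) - ((r : EReal) + (b : EReal)) =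
      ((a.toReal - b.toReal : ℝ) : EReal) := by
  lift a to NNReal using ha
  lift b to NNReal using hb
  change ((r : EReal) + ((a : ℝ) : EReal)) - ((r : EReal) + ((b : ℝ) : EReal)) = _
  rw [← EReal.coe_add, ← EReal.coe_add, ← EReal.coe_sub]
  congr 1
  simp

lemma IsNormalized.benefit_eq {Ω : Type*} [MeasurableSpace Ω]
    {ℓ : Fin n → A → EReal} {m : Fin n → ℝ} {e : Fin n → A → ℝ≥0∞} (h : IsNormalized ℓ m e)
    (μ : Measure Ω) [IsFiniteMeasure μ] {X : Ω → Fin n} (hX : Measurable X) {k : ℕ}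
    {Y : Ω → Fin k} (hY : Measurable Y) :
    benefit ℓ μ X Y = (((bayes e (fun x => μ {ω | X ω = x})).toReal -
      ∑ y, (bayes e (fun x => μ {ω | X ω = x ∧ Y ω = y})).toReal : ℝ) : EReal) := by
  have hfin : ∀ y, bayes e (fun x => μ {ω | X ω = x ∧ Y ω = y}) ≠ ⊤ := fun y =>
    bayes_ne_top h.exists_finite fun x => measure_ne_top μ _
  rw [benefit, h.risk_eq μ hX, h.riskGiven_finite μ hX hY, coe_add_sub_coe_add _
    (bayes_ne_top h.exists_finite fun x => measure_ne_top μ _)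
    (ENNReal.sum_ne_top.2 fun y _ => hfin y), ENNReal.toReal_sum fun y _ => hfin y]

end Loss

/-! ### Markov chains from channels -/

section Factor

variable {Ω 𝒰 𝒱 𝒵 : Type*} [MeasurableSpace Ω] [Fintype 𝒰] [MeasurableSpace 𝒰]
  [MeasurableSingletonClass 𝒰]

lemma sum_measure_eq_and (μ : Measure Ω) {U : Ω → 𝒰} (hU : Measurable U) (P : Ω → Prop) :
    ∑ u, μ {ω | U ω = u ∧ P ω} = μ {ω | P ω} := by
  have h := sum_measure_preimage_singleton (μ := μ.restrict {ω | P ω}) Finset.univ (f := U)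
    fun u _ => hU (measurableSet_singleton u)
  simp only [Finset.coe_univ, Set.preimage_univ, Measure.restrict_apply_univ] at h
  rw [← h]
  refine Finset.sum_congr rfl fun u _ => ?_
  rw [Measure.restrict_apply (hU (measurableSet_singleton u))]
  rfl

/-- The law of `(V, Z)` when `U` is generated from `V` by a channel. -/
lemma measure_eq_of_channel {μ : Measure Ω} {U : Ω → 𝒰} (hU : Measurable U) {V : Ω → 𝒱} {Z : Ω → 𝒵}
    {a : 𝒵 → 𝒱 → ℝ≥0∞} {k : 𝒱 → 𝒰 → ℝ≥0∞} (hk : ∀ v, ∑ u, k v u = 1)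
    (h : ∀ u v z, μ {ω | U ω = u ∧ V ω = v ∧ Z ω = z} = a z v * k v u) (v : 𝒱) (z : 𝒵) :
    μ {ω | V ω = v ∧ Z ω = z} = a z v := by
  rw [← sum_measure_eq_and μ hU]
  simp only [h, ← Finset.mul_sum, hk, mul_one]

lemma measure_eq_sum_of_channel [Fintype 𝒵] [MeasurableSpace 𝒵] [MeasurableSingletonClass 𝒵]
    {μ : Measure Ω} {U : Ω → 𝒰} (hU : Measurable U) {V : Ω → 𝒱} {Z : Ω → 𝒵} (hZ : Measurable Z)
    {a : 𝒵 → 𝒱 → ℝ≥0∞} {k : 𝒱 → 𝒰 → ℝ≥0∞} (hk : ∀ v, ∑ u, k v u = 1)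
    (h : ∀ u v z, μ {ω | U ω = u ∧ V ω = v ∧ Z ω = z} = a z v * k v u) (v : 𝒱) :
    μ {ω | V ω = v} = ∑ z, a z v := by
  rw [← sum_measure_eq_and μ hZ]
  refine Finset.sum_congr rfl fun z _ => ?_
  rw [← measure_eq_of_channel hU hk h v z]
  simp only [and_comm]

lemma markovChain_of_channel [Fintype 𝒵] [MeasurableSpace 𝒵] [MeasurableSingletonClass 𝒵]
    {μ : Measure Ω} {U : Ω → 𝒰} (hU : Measurable U) {V : Ω → 𝒱} {Z : Ω → 𝒵} (hZ : Measurable Z)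
    {a : 𝒵 → 𝒱 → ℝ≥0∞} {k : 𝒱 → 𝒰 → ℝ≥0∞} (hk : ∀ v, ∑ u, k v u = 1)
    (h : ∀ u v z, μ {ω | U ω = u ∧ V ω = v ∧ Z ω = z} = a z v * k v u) :
    MarkovChain μ U V Z := by
  intro u v z
  have h1 : μ {ω | U ω = u ∧ V ω = v} = ∑ z, a z v * k v u := by
    rw [← sum_measure_eq_and μ hZ]
    refine Finset.sum_congr rfl fun z _ => ?_
    rw [← h]
    congr 1
    ext ω
    simp only [Set.mem_ofPred_eq]
    tauto
  rw [h, measure_eq_sum_of_channel hU hZ hk h, measure_eq_of_channel hU hk h, h1,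
    ← Finset.sum_mul]
  ring

end Factor

/-! ### From the Data Processing Axiom to invariance of the defect -/

section Value

variable {n : ℕ} {A : Type*}

/-- `bayes` as a real functional. -/
noncomputable def value (e : Fin n → A → ℝ≥0∞) (p : Fin n → ℝ) : ℝ :=
  (bayes e fun x => ENNReal.ofReal (p x)).toReal

variable [MeasurableSpace A]

/-- The masses p, q and the channel `K` define a law of (X, T, Y) with binary Y. Its factorisations
through `K` and through `R` give the two Markov chains, and the axiom for this law compares the two
defects. -/
lemma IsNormalized.defect_le {ℓ : Fin n → A → EReal} {m : Fin n → ℝ} {e : Fin n → A → ℝ≥0∞}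
    (h : IsNormalized ℓ m e) (hdpa : DataProcessingAxiom ℓ) {K R : Fin n → Fin n → ℝ}
    {p q p' q' : Fin n → ℝ} (hK : 0 ≤ K) (hR : 0 ≤ R) (hK1 : ∀ x, ∑ t, K x t = 1)
    (hR1 : ∀ t, ∑ x, R t x = 1) (hp : 0 ≤ p) (hq : 0 ≤ q) (hp' : 0 ≤ p') (hq' : 0 ≤ q')
    (hpp : ∀ x t, p x * K x t = p' t * R t x) (hqq : ∀ x t, q x * K x t = q' t * R t x)
    (hmass : ∑ x, (p + q) x = 1) :
    value e (p' + q') - value e p' - value e q' ≤ value e (p + q) - value e p - value e q := by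
  set a : Fin 2 → Fin n → ℝ≥0∞ := fun y x => ENNReal.ofReal (![p, q] y x) with ha
  set a' : Fin 2 → Fin n → ℝ≥0∞ := fun y x => ENNReal.ofReal (![p', q'] y x) with ha'
  set k : Fin n → Fin n → ℝ≥0∞ := fun x t => ENNReal.ofReal (K x t) with hk
  set r : Fin n → Fin n → ℝ≥0∞ := fun t x => ENNReal.ofReal (R t x) with hr
  have hk1 : ∀ x, ∑ t, k x t = 1 := fun x => by
    rw [hk, ← ENNReal.ofReal_sum_of_nonneg fun t _ => hK x t, hK1, ENNReal.ofReal_one]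
  have hr1 : ∀ x, ∑ t, r x t = 1 := fun x => by
    rw [hr, ← ENNReal.ofReal_sum_of_nonneg fun t _ => hR x t, hR1, ENNReal.ofReal_one]
  have hak : ∀ y x t, a y x * k x t = a' y t * r t x := by
    intro y x t
    fin_cases y
    · simp only [ha, ha', hk, hr]
      rw [← ENNReal.ofReal_mul' (hK x t), ← ENNReal.ofReal_mul' (hR t x)]
      simp [hpp]
    · simp only [ha, ha', hk, hr]
      rw [← ENNReal.ofReal_mul' (hK x t), ← ENNReal.ofReal_mul' (hR t x)]
      simp [hqq]
  let Ω := Fin n × Fin n × Fin 2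
  let μ : Measure Ω := ∑ ω : Ω, (a ω.2.2 ω.1 * k ω.1 ω.2.1) • Measure.dirac ω
  have hsingle : ∀ x t y, μ {ω | ω = (x, t, y)} = a y x * k x t := by
    intro x t y
    simp only [μ, Measure.finsetSum_apply, Measure.smul_apply, smul_eq_mul]
    rw [Finset.sum_eq_single (x, t, y)]
    · simp
    · intro ω _ hω
      simp [hω]
    · simp
  have hX : Measurable fun ω : Ω => ω.1 := measurable_fst
  have hT : Measurable fun ω : Ω => ω.2.1 := measurable_snd.fst
  have hY : Measurable fun ω : Ω => ω.2.2 := measurable_snd.snd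
  have hTX : ∀ t x y, μ {ω | ω.2.1 = t ∧ ω.1 = x ∧ ω.2.2 = y} = a y x * k x t := by
    intro t x y
    rw [← hsingle]
    congr 1
    ext ω
    constructor
    · rintro ⟨rfl, rfl, rfl⟩
      rfl
    · rintro rfl
      exact ⟨rfl, rfl, rfl⟩
  have hXT : ∀ x t y, μ {ω | ω.1 = x ∧ ω.2.1 = t ∧ ω.2.2 = y} = a' y t * r t x := by
    intro x t y
    rw [← hak, ← hsingle]
    congr 1
    ext ω
    constructor
    · rintro ⟨rfl, rfl, rfl⟩
      rfl
    · rintro rfl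
      exact ⟨rfl, rfl, rfl⟩
  have hμX := measure_eq_sum_of_channel hT hY hk1 hTX
  have hμXY := measure_eq_of_channel hT hk1 hTX
  have hμT := measure_eq_sum_of_channel hX hY hr1 hXT
  have hμTY := measure_eq_of_channel hX hr1 hXT
  have hμ : IsProbabilityMeasure μ := by
    refine ⟨?_⟩
    have h1 := sum_measure_eq_and μ hX fun _ => True
    simp only [and_true, hμX, Fin.sum_univ_two, ha] at h1
    rw [← Set.ofPred_true, ← h1, ← ENNReal.ofReal_one, ← hmass,
      ENNReal.ofReal_sum_of_nonneg fun x _ => (add_nonneg hp hq) x]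
    exact Finset.sum_congr rfl fun x _ => (ENNReal.ofReal_add (hp x) (hq x)).symm
  have hle := hdpa Ω μ 2 (fun ω => ω.1) (fun ω => ω.2.1) (fun ω => ω.2.2) hX hT hY
    ⟨markovChain_of_channel hT hY hk1 hTX, markovChain_of_channel hX hY hr1 hXT⟩
  rw [h.benefit_eq μ hX hY, h.benefit_eq μ hT hY, EReal.coe_le_coe_iff] at hle
  simp only [hμX, hμXY, hμT, hμTY, Fin.sum_univ_two, ha, ha', Matrix.cons_val_zero,
    Matrix.cons_val_one] at hle
  have hsum : ∀ {p q : Fin n → ℝ}, 0 ≤ p → 0 ≤ q →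
      (fun x => ENNReal.ofReal (p x) + ENNReal.ofReal (q x)) =
        fun x => ENNReal.ofReal ((p + q) x) := fun hp hq => by
    ext x
    exact (ENNReal.ofReal_add (hp x) (hq x)).symm
  rw [hsum hp hq, hsum hp' hq'] at hle
  simp only [value]
  linarith

lemma IsNormalized.isSufficiencyInvariant {ℓ : Fin n → A → EReal} {m : Fin n → ℝ}
    {e : Fin n → A → ℝ≥0∞} (h : IsNormalized ℓ m e) (hdpa : DataProcessingAxiom ℓ) :
    IsSufficiencyInvariant (value e) := by
  have : Nonempty A := ⟨h.exists_finite.choose⟩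
  have hsmul : ∀ (c : ℝ) (p : Fin n → ℝ), 0 ≤ c → 0 ≤ p → value e (c • p) = c * value e p := by
    intro c p hc hp
    have h1 : bayes e (fun x => ENNReal.ofReal ((c • p) x)) =
        ENNReal.ofReal c * bayes e (fun x => ENNReal.ofReal (p x)) := by
      rw [bayes, bayes, ENNReal.mul_iInf (fun h => absurd h ENNReal.ofReal_ne_top)]
      refine iInf_congr fun a => ?_
      rw [Finset.mul_sum]
      refine Finset.sum_congr rfl fun x _ => ?_
      rw [Pi.smul_apply, smul_eq_mul, ENNReal.ofReal_mul hc, mul_assoc]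
    rw [value, h1, ENNReal.toReal_mul, ENNReal.toReal_ofReal hc, value]
  have hfin : ∀ p : Fin n → ℝ, bayes e (fun x => ENNReal.ofReal (p x)) ≠ ⊤ := fun p =>
    bayes_ne_top h.exists_finite fun x => ENNReal.ofReal_ne_top
  refine ⟨hsmul, ?_, fun p _ => ENNReal.toReal_nonneg, ?_, ?_⟩
  · intro p q hp hq
    rw [value, value, value, ← ENNReal.toReal_add (hfin p) (hfin q)]
    refine ENNReal.toReal_mono (hfin _) (le_iInf fun a => ?_)
    calc _ ≤ ∑ x, ENNReal.ofReal (p x) * e x a + ∑ x, ENNReal.ofReal (q x) * e x a :=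
          add_le_add (iInf_le _ a) (iInf_le _ a)
      _ = _ := by
        rw [← Finset.sum_add_distrib]
        refine Finset.sum_congr rfl fun x _ => ?_
        rw [← add_mul, ← ENNReal.ofReal_add (hp x) (hq x)]
        rfl
  · intro x
    have h1 : bayes e (fun y => ENNReal.ofReal ((Pi.single x 1 : Fin n → ℝ) y)) = ⨅ a, e x a := by
      refine iInf_congr fun a => ?_
      rw [Finset.sum_eq_single x (fun y _ hy => by simp [hy]) (by simp)]
      simp
    rw [value, h1, h.iInf_eq, ENNReal.toReal_zero]
  · have hmass : ∀ {K R : Fin n → Fin n → ℝ} {p p' : Fin n → ℝ}, (∀ x, ∑ t, K x t = 1) →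
        (∀ t, ∑ x, R t x = 1) → (∀ x t, p x * K x t = p' t * R t x) →
        ∑ x, p x = ∑ t, p' t := by
      intro K R p p' hK1 hR1 hpp
      calc ∑ x, p x = ∑ x, ∑ t, p x * K x t := by simp only [← Finset.mul_sum, hK1, mul_one]
        _ = ∑ t, ∑ x, p' t * R t x := by rw [Finset.sum_comm]; simp only [hpp]
        _ = ∑ t, p' t := by simp only [← Finset.mul_sum, hR1, mul_one]
    have hle : ∀ {K R : Fin n → Fin n → ℝ} {p q p' q' : Fin n → ℝ},
        0 ≤ K → 0 ≤ R → (∀ x, ∑ t, K x t = 1) → (∀ t, ∑ x, R t x = 1) →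
        0 ≤ p → 0 ≤ q → 0 ≤ p' → 0 ≤ q' →
        (∀ x t, p x * K x t = p' t * R t x) → (∀ x t, q x * K x t = q' t * R t x) →
        value e (p' + q') - value e p' - value e q' ≤
          value e (p + q) - value e p - value e q := by
      intro K R p q p' q' hK hR hK1 hR1 hp hq hp' hq' hpp hqq
      have hs : 0 ≤ ∑ x, (p + q) x := Finset.sum_nonneg fun x _ => add_nonneg (hp x) (hq x)
      -- The axiom concerns probability measures: positive mass is rescaled to 1, and zero mass
      -- makes all four vectors vanish because channels preserve mass.
      rcases hs.lt_or_eq with hpos | hzero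
      · set s := ∑ x, (p + q) x with hsdef
        have hs' : 0 ≤ s⁻¹ := inv_nonneg.2 hs
        have h1 := h.defect_le hdpa (p := s⁻¹ • p) (q := s⁻¹ • q) (p' := s⁻¹ • p')
          (q' := s⁻¹ • q') hK hR hK1 hR1 (smul_nonneg hs' hp) (smul_nonneg hs' hq)
          (smul_nonneg hs' hp') (smul_nonneg hs' hq')
          (fun x t => by simp only [Pi.smul_apply, smul_eq_mul, mul_assoc, hpp])
          (fun x t => by simp only [Pi.smul_apply, smul_eq_mul, mul_assoc, hqq])
          (by
            rw [← smul_add]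
            simp only [Pi.smul_apply, smul_eq_mul]
            rw [← Finset.mul_sum, ← hsdef, inv_mul_cancel₀ hpos.ne'])
        rw [← smul_add, ← smul_add, hsmul _ _ hs' hp, hsmul _ _ hs' hq, hsmul _ _ hs' hp',
          hsmul _ _ hs' hq', hsmul _ _ hs' (add_nonneg hp hq), hsmul _ _ hs' (add_nonneg hp' hq'),
          ← mul_sub, ← mul_sub, ← mul_sub, ← mul_sub] at h1
        exact le_of_mul_le_mul_left h1 (inv_pos.2 hpos)
      · have h0 : ∀ {p q : Fin n → ℝ}, 0 ≤ p → 0 ≤ q → ∑ x, p x + ∑ x, q x = 0 →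
            p = 0 ∧ q = 0 := by
          intro p q hp hq hpq
          have hp0 : 0 ≤ ∑ x, p x := Finset.sum_nonneg fun x _ => hp x
          have hq0 : 0 ≤ ∑ x, q x := Finset.sum_nonneg fun x _ => hq x
          exact ⟨(Fintype.sum_eq_zero_iff_of_nonneg hp).1 (by linarith),
            (Fintype.sum_eq_zero_iff_of_nonneg hq).1 (by linarith)⟩
        simp only [Pi.add_apply, Finset.sum_add_distrib] at hzero
        have hzero' := hzero
        rw [hmass hK1 hR1 hpp, hmass hK1 hR1 hqq] at hzero'
        obtain ⟨rfl, rfl⟩ := h0 hp hq hzero.symm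
        obtain ⟨rfl, rfl⟩ := h0 hp' hq' hzero'.symm
        exact le_rfl
    intro K R p q p' q' hK hR hK1 hR1 hp hq hp' hq' hpp hqq
    -- The hypotheses are symmetric under exchanging `K` with `R` and p, q with p', q', which gives
    -- the reverse inequality.
    exact le_antisymm (hle hK hR hK1 hR1 hp hq hp' hq' hpp hqq)
      (hle hR hK hR1 hK1 hp' hq' hp hq (fun x t => (hpp t x).symm) fun x t => (hqq t x).symm)

end Value

/-! ### Optimal risk and conditional entropy -/

section Entropy

variable {n : ℕ} {A : Type*} [MeasurableSpace A]

lemma negMulLog_mem_Icc {x : ℝ} (h0 : 0 ≤ x) (h1 : x ≤ 1) : Real.negMulLog x ∈ Set.Icc 0 1 := by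
  refine ⟨Real.negMulLog_nonneg h0 h1, ?_⟩
  rcases h0.lt_or_eq with h | rfl
  · have h2 := mul_le_mul_of_nonneg_left (Real.one_sub_inv_le_log_of_pos h) h0
    rw [mul_sub, mul_inv_cancel₀ h.ne'] at h2
    rw [Real.negMulLog]
    linarith
  · simp

/-- The optimal risk given side information is affine in the conditional entropy. -/
lemma IsNormalized.riskGiven_eq_condEntropy [NeZero n] {ℓ : Fin n → A → EReal} {m : Fin n → ℝ}
    {e : Fin n → A → ℝ≥0∞} (h : IsNormalized ℓ m e) {c : ℝ} (hc : 0 ≤ c)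
    (hval : ∀ p : Fin n → ℝ, 0 ≤ p → value e p =
      c * ((∑ x, p x) * Real.log (∑ x, p x) - ∑ x, p x * Real.log (p x)))
    {Ω 𝒮 : Type*} [MeasurableSpace Ω] [MeasurableSpace 𝒮] (μ : Measure Ω) [IsProbabilityMeasure μ]
    {X : Ω → Fin n} (hX : Measurable X) {S : Ω → 𝒮} (hS : Measurable S) :
    riskGiven ℓ μ X S = ((∫ ω, m (X ω) ∂μ + c * condEntropy μ X S : ℝ) : EReal) := by
  -- The regular conditional law of X exists for arbitrary S because the alphabet of X is finite.
  set κ := ProbabilityTheory.condDistrib X S μ with hκdef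
  have hκ : ∀ x, Measurable fun s => κ s {x} := fun x =>
    κ.measurable_coe (measurableSet_singleton x)
  -- At a probability vector the total mass is 1, so only the entropy sum remains.
  have hbayes : ∀ s, bayes e (fun x => κ s {x}) =
      ENNReal.ofReal (c * ∑ x, Real.negMulLog ((κ s).real {x})) := by
    intro s
    have h1 := hval (fun x => (κ s).real {x}) fun x => measureReal_nonneg
    have h2 : ∑ x, (κ s).real {x} = 1 := by
      rw [sum_measureReal_singleton, Finset.coe_univ, probReal_univ]
    rw [h2, Real.log_one, mul_zero, zero_sub] at h1
    have h3 : (fun x => ENNReal.ofReal ((κ s).real {x})) = fun x => κ s {x} := by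
      ext x
      exact ofReal_measureReal
    rw [value, h3] at h1
    rw [← ENNReal.ofReal_toReal (bayes_ne_top h.exists_finite fun x => measure_ne_top (κ s) {x}),
      h1]
    simp only [Real.negMulLog, neg_mul, Finset.sum_neg_distrib]
  have hdis : ∀ g : {g : 𝒮 → A // Measurable g}, ∫⁻ ω, e (X ω) (g.1 (S ω)) ∂μ =
      ∫⁻ s, ∑ x, κ s {x} * e x (g.1 s) ∂(μ.map S) := by
    intro g
    have hf : Measurable fun q : 𝒮 × Fin n => e q.2 (g.1 q.1) :=
      measurable_loss_comp h.measurable measurable_snd (g.2.comp measurable_fst)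
    rw [← lintegral_map (f := fun q : 𝒮 × Fin n => e q.2 (g.1 q.1)) hf (hS.prodMk hX),
      ← ProbabilityTheory.compProd_map_condDistrib hX.aemeasurable, Measure.lintegral_compProd hf]
    refine lintegral_congr fun s => ?_
    rw [lintegral_fintype]
    exact Finset.sum_congr rfl fun x _ => mul_comm _ _
  have hprob : IsProbabilityMeasure (μ.map S) := Measure.isProbabilityMeasure_map hS.aemeasurable
  have hmeasH : Measurable fun s => ∑ x, Real.negMulLog ((κ s).real {x}) :=
    Finset.measurable_sum _ fun x _ =>
      Real.continuous_negMulLog.measurable.comp (hκ x).ennreal_toReal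
  have hbd : ∀ s x, Real.negMulLog ((κ s).real {x}) ∈ Set.Icc 0 1 := fun s x =>
    negMulLog_mem_Icc measureReal_nonneg measureReal_le_one
  have hH0 : ∀ s, 0 ≤ ∑ x, Real.negMulLog ((κ s).real {x}) := fun s =>
    Finset.sum_nonneg fun x _ => (hbd s x).1
  have hint : Integrable (fun ω => c * ∑ x, Real.negMulLog ((κ (S ω)).real {x})) μ := by
    refine Integrable.const_mul (Integrable.of_bound (hmeasH.comp hS).aestronglyMeasurable
      (∑ _x : Fin n, (1 : ℝ)) (Filter.Eventually.of_forall fun ω => ?_)) c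
    rw [Function.comp_apply, Real.norm_of_nonneg (hH0 _)]
    exact Finset.sum_le_sum fun x _ => (hbd _ x).2
  -- `condEntropy` uses conditional expectations; for the finitely many x they agree almost
  -- everywhere with κ.
  have hent : ∫ ω, ∑ x, Real.negMulLog ((κ (S ω)).real {x}) ∂μ = condEntropy μ X S := by
    refine integral_congr_ae ?_
    have hae : ∀ x, (fun ω => (κ (S ω)).real {x}) =ᵐ[μ] _ := fun x =>
      ProbabilityTheory.condDistrib_ae_eq_condExp hS hX (measurableSet_singleton x)
    filter_upwards [ae_all_iff.2 hae] with ω hω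
    exact Finset.sum_congr rfl fun x _ => by rw [hω x]
  have hce : 0 ≤ condEntropy μ X S := hent ▸ integral_nonneg fun ω => hH0 _
  rw [h.riskGiven_eq μ hX hS]
  simp only [hdis]
  rw [iInf_lintegral_eq_lintegral_bayes h.exists_finite (μ.map S) hκ
    fun s x => measure_ne_top (κ s) {x}]
  simp only [hbayes]
  rw [lintegral_map (hmeasH.const_mul c).ennreal_ofReal hS,
    ← ofReal_integral_eq_lintegral_ofReal hint
      (Filter.Eventually.of_forall fun ω => mul_nonneg hc (hH0 _)),
    integral_const_mul, hent, EReal.coe_ennreal_ofReal, max_eq_left (mul_nonneg hc hce),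
    EReal.coe_add]

end Entropy

end SideInfo

/-! ### The main theorem: difference of two optimal risks -/

theorem corollary1 {n : ℕ} (hn : 3 ≤ n) {A : Type*} [MeasurableSpace A]
    (ℓ : Fin n → A → EReal) (hmeas : ∀ x, Measurable (ℓ x))
    (hwd : SideInfo.WellDefined ℓ) (hdpa : SideInfo.DataProcessingAxiom ℓ) :
    ∃ c : ℝ, 0 ≤ c ∧
      ∀ (Ω : Type*) (𝒴 : Type*) (𝒲 : Type*) [MeasurableSpace Ω] [MeasurableSpace 𝒴]
        [MeasurableSpace 𝒲] (μ : Measure Ω) [IsProbabilityMeasure μ]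
        (X : Ω → Fin n) (Y : Ω → 𝒴) (W : Ω → 𝒲),
        Measurable X → Measurable Y → Measurable W →
        SideInfo.benefitGiven ℓ μ X Y W = ((c * SideInfo.condMutualInfo μ X Y W : ℝ) : EReal) := by
  have : NeZero n := ⟨by omega⟩
  obtain ⟨m, e, he⟩ := hwd.exists_normalization (by omega) hmeas
  obtain ⟨c, hc, hval⟩ := (he.isSufficiencyInvariant hdpa).eq_entropy hn
  refine ⟨c, hc, fun Ω 𝒴 𝒲 _ _ _ μ _ X Y W hX hY hW => ?_⟩
  rw [SideInfo.benefitGiven, he.riskGiven_eq_condEntropy hc hval μ hX hW,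
    he.riskGiven_eq_condEntropy hc hval μ hX (hY.prodMk hW), ← EReal.coe_sub,
    SideInfo.condMutualInfo]
  congr 1
  ring
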